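/- Let $m,n,o\in\mathbb N$, let $\pi$ be a probability vector on the intents $[m]$, let $U$ be a row-stochastic $m\times n$ matrix (the user's fixed strategy, from intents to queries), let $r:[m]\times[o]\to[0,\infty)$ be an arbitrary effectiveness measure between intents and results, and let $R(0)$ be a deterministic $n\times o$ matrix with strictly positive entries. For an $n\times o$ matrix $D$ put $$u_r(U,D)=\sum_{i=1}^m\pi_i\sum_{j=1}^nU_{ij}\sum_{\ell=1}^oD_{j\ell}\,r_{i\ell}.$$ The game is played in rounds $t=0,1,2,\dots$, and the DBMS strategy in round $t$ is the row-normalised reward matrix $$D_{j\ell}(t)=\frac{R_{j\ell}(t)}{\sum_{\ell'=1}^oR_{j\ell'}(t)}.$$ In round $t$ an intent $i(t)\in[m]$, a query $q(t)\in[n]$ and a result $E(t)\in[o]$ occur such that, conditionally on all earlier rounds, $$P\big(i(t)=i,\ q(t)=j,\ E(t)=\ell\big)=\pi_i\,U_{ij}\,D_{j\ell}(t)\qquad\text{for all } i,j,\ell;$$ then $R_{q(t)E(t)}(t+1)=R_{q(t)E(t)}(t)+r_{i(t)E(t)}$, and all other entries of $R(t+1)$ equal those of $R(t)$. Let $u(t)=u_r(U,D(t))$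 and let $\mathcal F_t$ be the $\sigma$-algebra generated by $D(0),\dots,D(t)$. Then $u(t)$ is integrable and $\mathcal F_t$-measurable for every $t$, and there is a nonnegative random process $(\beta_t)_{t\ge0}$, with $\beta_t$ being $\mathcal F_t$-measurable, such that $\sum_{t=0}^\infty\beta_t<\infty$ almost surely and, for every $t$, $$E(u(t+1)\mid\mathcal F_t)\ \ge\ u(t)-\beta_t\quad\text{almost surely}.$$ As a result, $u(t)$ converges almost surely to a finite limit. -/

import Mathlib

open MeasureTheory ProbabilityTheory Filter Topology

noncomputable section

namespace DataGame

/-- The expected payoff `u_r(U, D) = ∑ i, π i ∑ j, U i j ∑ l, D j l * r i l` of the user strategy `U`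
(intents to queries) and the DBMS strategy `D` (queries to results), for the prior `π` on intents
and the effectiveness measure `r`. -/
def payoff {m n o : ℕ} (π : Fin m → ℝ) (U : Fin m → Fin n → ℝ) (r : Fin m → Fin o → ℝ)
    (D : Fin n → Fin o → ℝ) : ℝ :=
  ∑ i, π i * ∑ j, U i j * ∑ l, D j l * r i l

section Processes

variable {Ω : Type*} {m n o : ℕ}

/-- The accumulated reward matrix `R(t)`: it starts at `R(0) = R₀`, and after round `t`, in which the
user has the intent `intent t`, submits `query t` and is shown `result t`, the entry
`(query t, result t)` grows by the reward `r (intent t) (result t)`. -/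
def rewardMatrix (R₀ : Fin n → Fin o → ℝ) (r : Fin m → Fin o → ℝ)
    (intent : ℕ → Ω → Fin m) (query : ℕ → Ω → Fin n) (result : ℕ → Ω → Fin o) :
    ℕ → Ω → Fin n → Fin o → ℝ
  | 0 => fun _ => R₀
  | t + 1 => fun ω j l =>
      if j = query t ω ∧ l = result t ω then
        rewardMatrix R₀ r intent query result t ω j l + r (intent t ω) l
      else rewardMatrix R₀ r intent query result t ω j l

/-- The DBMS strategy `D(t)`: the reward matrix `R(t)`, normalised by row. -/
def strategy (R₀ : Fin n → Fin o → ℝ) (r : Fin m → Fin o → ℝ)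
    (intent : ℕ → Ω → Fin m) (query : ℕ → Ω → Fin n) (result : ℕ → Ω → Fin o)
    (t : ℕ) (ω : Ω) (j : Fin n) (l : Fin o) : ℝ :=
  rewardMatrix R₀ r intent query result t ω j l /
    ∑ l', rewardMatrix R₀ r intent query result t ω j l'

/-- The σ-algebra generated by everything that happened in the rounds before round `t`. -/
abbrev past (intent : ℕ → Ω → Fin m) (query : ℕ → Ω → Fin n) (result : ℕ → Ω → Fin o)
    (t : ℕ) : MeasurableSpace Ω :=
  ⨆ s : ℕ, ⨆ _ : s < t,
    MeasurableSpace.comap (fun ω => (intent s ω, query s ω, result s ω)) inferInstance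

/-- The processes `intent`, `query`, `result` are a play of the game with prior `π` and fixed user
strategy `U` in which the DBMS follows the Roth-Erev rule started from `R₀`: given the rounds
before round `t`, the intent is `i` with probability `π i`, it is expressed by the query `j` with
probability `U i j`, and the DBMS, which sees only the query, answers `l` with probability
`D(t) j l`. -/
structure IsRothErevPlay [MeasurableSpace Ω] (μ : Measure Ω) (π : Fin m → ℝ)
    (U : Fin m → Fin n → ℝ) (r : Fin m → Fin o → ℝ) (R₀ : Fin n → Fin o → ℝ)
    (intent : ℕ → Ω → Fin m) (query : ℕ → Ω → Fin n) (result : ℕ → Ω → Fin o) : Prop where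
  measurable_intent : ∀ t, Measurable (intent t)
  measurable_query : ∀ t, Measurable (query t)
  measurable_result : ∀ t, Measurable (result t)
  law : ∀ (t : ℕ) (i : Fin m) (j : Fin n) (l : Fin o),
    μ[({ω | intent t ω = i ∧ query t ω = j ∧ result t ω = l}.indicator fun _ => (1 : ℝ)) |
        past intent query result t]
      =ᵐ[μ] fun ω => π i * U i j * strategy R₀ r intent query result t ω j l

variable [MeasurableSpace Ω] {μ : Measure Ω} {π : Fin m → ℝ}
  {U : Fin m → Fin n → ℝ} {r : Fin m → Fin o → ℝ} {R₀ : Fin n → Fin o → ℝ}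
  {intent : ℕ → Ω → Fin m} {query : ℕ → Ω → Fin n} {result : ℕ → Ω → Fin o}

theorem IsRothErevPlay.measurable_rewardMatrix
    (h : IsRothErevPlay μ π U r R₀ intent query result) (t : ℕ) (j : Fin n) (l : Fin o) :
    Measurable fun ω => rewardMatrix R₀ r intent query result t ω j l := by
  induction t with
  | zero => exact measurable_const
  | succ t ih =>
    refine Measurable.ite ?_ (ih.add ?_) ih
    · exact (measurableSet_eq_fun measurable_const (h.measurable_query t)).inter
        (measurableSet_eq_fun measurable_const (h.measurable_result t))
    · exact (measurable_of_finite fun i => r i l).comp (h.measurable_intent t)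

theorem IsRothErevPlay.stronglyMeasurable_strategy
    (h : IsRothErevPlay μ π U r R₀ intent query result) (t : ℕ) :
    StronglyMeasurable (strategy R₀ r intent query result t) := by
  refine Measurable.stronglyMeasurable ?_
  refine measurable_pi_lambda _ fun j => measurable_pi_lambda _ fun l => ?_
  exact (h.measurable_rewardMatrix t j l).div
    (Finset.measurable_sum _ fun l' _ => h.measurable_rewardMatrix t j l')

/-- The natural filtration of the process `D(t)`: `F t` is generated by `D(0), …, D(t)`. -/
def IsRothErevPlay.filtration (h : IsRothErevPlay μ π U r R₀ intent query result) :
    Filtration ℕ (inferInstance : MeasurableSpace Ω) :=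
  Filtration.natural (strategy R₀ r intent query result) h.stronglyMeasurable_strategy

end Processes

end DataGame

end

/-!
In a round with intent `i`, query `j` and result `e`, only the row `j` of the reward matrix changes.
Write `S j` for the row sum, `w j l = ∑ i, π i * U i j * r i l` for the coefficient of `D j l` in
the payoff and `w̄ j = ∑ l, D j l * w j l`, so that the payoff is `∑ j, w̄ j`. With `x = r i e` the
payoff grows by `x * (w j e - w̄ j) / (S j + x)`. Replacing the denominator by `S j` costs at most
`c * (1 / S j - 1 / (S j + x))`, where `c = M * M` for a bound `M` of `r`; this is exactly the
amount by which the correction `V = ∑ j, c / S j` decreases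
(`DataGame.reward_mul_advantage_le_increment`). The conditional mean of
`x * (w j e - w̄ j) / S j` given the past is `∑ j, Var (w j) / S j ≥ 0`, the variance being taken
under the `j`-th row of `D` (`DataGame.sum_law_mul_advantage_nonneg`). Hence `u - V` is a
submartingale for the filtration of all past rounds
(`DataGame.IsRothErevPlay.submartingale_payoff_sub_correction`).

As `u - V` is bounded it converges almost surely, and so does the nonnegative decreasing `V`, hence
so does `u`. The filtration generated by the strategies is coarser than that of the past, and the
row sums need not be adapted to it, so `β t` is taken to be the conditional expectation of
`V t - V (t + 1)` given the former. It is summable because its expectations telescope to at most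
the expectation of `V 0` (`DataGame.exists_summable_drift_bound`).
-/

noncomputable section

namespace DataGame

/-! ### Submartingales up to a decreasing correction -/

section AlmostSubmartingale

variable {Ω : Type*} {m0 : MeasurableSpace Ω} {μ : Measure Ω}

theorem ae_summable_of_sum_integral_le {f : ℕ → Ω → ℝ} (hf : ∀ t, Integrable (f t) μ)
    (hf0 : ∀ t ω, 0 ≤ f t ω) {c : ℝ} (hc : ∀ N, ∑ t ∈ Finset.range N, ∫ ω, f t ω ∂μ ≤ c) :
    ∀ᵐ ω ∂μ, Summable fun t => f t ω := by
  have hsum : Summable fun t => ∫ ω, f t ω ∂μ :=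
    summable_of_sum_range_le (fun t => integral_nonneg (hf0 t)) hc
  have key := MeasureTheory.summable_norm_of_tsum_eLpNorm_ne_top (μ := μ) (p := 1) le_rfl
    (fun t => (hf t).aestronglyMeasurable) ?_
  · filter_upwards [key] with ω hω
    exact hω.of_norm
  · have h1 : ∀ t, eLpNorm (f t) 1 μ = ENNReal.ofReal (∫ ω, f t ω ∂μ) := fun t => by
      rw [eLpNorm_one_eq_lintegral_enorm,
        ofReal_integral_eq_lintegral_ofReal (hf t) (Eventually.of_forall (hf0 t))]
      exact lintegral_congr fun ω => Real.enorm_of_nonneg (hf0 t ω)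
    simp_rw [h1]
    exact hsum.tsum_ofReal_ne_top

variable [IsFiniteMeasure μ] {𝒢 ℱ : Filtration ℕ m0} {u V : ℕ → Ω → ℝ}

/-- If `u - V` is a submartingale for some antitone process `V`, then the conditional drift of `u`
on a smaller filtration `ℱ` is at least `-β`, where `β t` is the `ℱ t`-conditional expectation of
the decrement of `V`. The expectations of the `β t` telescope. -/
theorem exists_summable_drift_bound (hle : ∀ t, ℱ t ≤ 𝒢 t) (hu : StronglyAdapted ℱ u)
    (hui : ∀ t, Integrable (u t) μ) (hVi : ∀ t, Integrable (V t) μ)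
    (hVanti : ∀ ω, Antitone fun t => V t ω) (hV0 : ∀ t ω, 0 ≤ V t ω)
    (hsub : Submartingale (fun t ω => u t ω - V t ω) 𝒢 μ) :
    ∃ β : ℕ → Ω → ℝ, StronglyAdapted ℱ β ∧ (∀ t ω, 0 ≤ β t ω) ∧
      (∀ᵐ ω ∂μ, Summable fun t => β t ω) ∧
      ∀ t, ∀ᵐ ω ∂μ, u t ω - β t ω ≤ (μ[u (t + 1) | ℱ t]) ω := by
  have hdec : ∀ t, Integrable (V t - V (t + 1)) μ := fun t => (hVi t).sub (hVi (t + 1))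
  have hdec0 : ∀ t, 0 ≤ᵐ[μ] μ[V t - V (t + 1) | ℱ t] := fun t =>
    condExp_nonneg (Eventually.of_forall fun ω => sub_nonneg.2 (hVanti ω t.le_succ))
  -- The conditional expectation is nonnegative only almost surely, hence the absolute value.
  refine ⟨fun t ω => |(μ[V t - V (t + 1) | ℱ t]) ω|,
    fun t => (stronglyMeasurable_condExp (m := ℱ t) (μ := μ) (f := V t - V (t + 1))).norm,
    fun t ω => abs_nonneg _, ?_, fun t => ?_⟩
  · refine ae_summable_of_sum_integral_le
      (fun t => (integrable_condExp (m := ℱ t) (μ := μ) (f := V t - V (t + 1))).norm)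
      (fun t ω => abs_nonneg _) (c := ∫ ω, V 0 ω ∂μ) fun N => ?_
    have hint : ∀ t, ∫ ω, |(μ[V t - V (t + 1) | ℱ t]) ω| ∂μ
        = ∫ ω, V t ω ∂μ - ∫ ω, V (t + 1) ω ∂μ := fun t => by
      rw [← integral_sub (hVi t) (hVi (t + 1))]
      refine Eq.trans (integral_congr_ae ?_) (integral_condExp (ℱ.le t))
      filter_upwards [hdec0 t] with ω hω
      exact abs_of_nonneg hω
    simp_rw [hint]
    rw [Finset.sum_range_sub']
    exact sub_le_self _ (integral_nonneg (hV0 N))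
  · have h1 : 0 ≤ᵐ[μ] μ[μ[(fun ω => u (t + 1) ω - V (t + 1) ω) - (fun ω => u t ω - V t ω) | 𝒢 t]
        | ℱ t] := condExp_nonneg (hsub.condExp_sub_nonneg t.le_succ)
    have h2 := condExp_condExp_of_le (μ := μ) (hle t) (𝒢.le t)
      (f := (fun ω => u (t + 1) ω - V (t + 1) ω) - (fun ω => u t ω - V t ω))
    have h3 : (fun ω => u (t + 1) ω - V (t + 1) ω) - (fun ω => u t ω - V t ω)
        = u (t + 1) - u t + (V t - V (t + 1)) := by
      funext ω
      simp only [Pi.sub_apply, Pi.add_apply]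
      ring
    rw [h3] at h1 h2
    have h4 := condExp_add ((hui (t + 1)).sub (hui t)) (hdec t) (ℱ t)
    have h5 := condExp_sub (hui (t + 1)) (hui t) (ℱ t)
    rw [condExp_of_stronglyMeasurable (ℱ.le t) (hu t) (hui t)] at h5
    filter_upwards [h1, h2, h4, h5] with ω g1 g2 g4 g5
    rw [g2, g4, Pi.add_apply, g5, Pi.sub_apply, Pi.zero_apply] at g1
    linarith [le_abs_self ((μ[V t - V (t + 1) | ℱ t]) ω)]

/-- A bounded process is almost surely convergent if it becomes a submartingale after subtracting
a nonnegative antitone process: both the submartingale and the correction converge. -/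
theorem ae_exists_tendsto_of_submartingale_sub {B : ℝ} (huB : ∀ t ω, |u t ω| ≤ B)
    (hVanti : ∀ ω, Antitone fun t => V t ω) (hV0 : ∀ t ω, 0 ≤ V t ω) {B' : ℝ}
    (hVB : ∀ ω, V 0 ω ≤ B') (hsub : Submartingale (fun t ω => u t ω - V t ω) 𝒢 μ) :
    ∀ᵐ ω ∂μ, ∃ c : ℝ, Tendsto (fun t => u t ω) atTop (𝓝 c) := by
  have hbdd : ∀ t, eLpNorm (fun ω => u t ω - V t ω) 1 μ
      ≤ ((μ Set.univ).toNNReal * (B + B').toNNReal : NNReal) := fun t => by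
    refine (eLpNorm_le_of_ae_bound (C := B + B') (Eventually.of_forall fun ω => ?_)).trans ?_
    · rw [Real.norm_eq_abs, abs_le]
      have h1 := abs_le.1 (huB t ω)
      have h2 := hV0 t ω
      have h3 := (hVanti ω t.zero_le).trans (hVB ω)
      constructor <;> linarith
    · simp [ENNReal.ofReal]
  filter_upwards [hsub.exists_ae_tendsto_of_bdd hbdd] with ω ⟨c, hc⟩
  have hV := tendsto_atTop_ciInf (hVanti ω) ⟨0, by rintro _ ⟨t, rfl⟩; exact hV0 t ω⟩
  exact ⟨_, by simpa using hc.add hV⟩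

end AlmostSubmartingale

/-! ### One round of the game -/

/-- The effectiveness of the result `l` summed over the intents, each weighted by the probability
`π i * U i j` that the user has this intent and expresses it by the query `j`: the coefficient of
`D j l` in the payoff. -/
def resultValue {m n o : ℕ} (π : Fin m → ℝ) (U : Fin m → Fin n → ℝ) (r : Fin m → Fin o → ℝ)
    (j : Fin n) (l : Fin o) : ℝ :=
  ∑ i, π i * U i j * r i l

section Deterministic

variable {m n o : ℕ} {π : Fin m → ℝ} {U : Fin m → Fin n → ℝ} {r : Fin m → Fin o → ℝ}

theorem payoff_eq_sum_resultValue (D : Fin n → Fin o → ℝ) :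
    payoff π U r D = ∑ j, ∑ l, D j l * resultValue π U r j l := by
  simp only [payoff, resultValue, Finset.mul_sum]
  rw [Finset.sum_comm]
  refine Finset.sum_congr rfl fun j _ => ?_
  rw [Finset.sum_comm]
  refine Finset.sum_congr rfl fun l _ => Finset.sum_congr rfl fun i _ => ?_
  ring

theorem resultValue_nonneg (hπ : π ∈ stdSimplex ℝ (Fin m))
    (hU : ∀ i, U i ∈ stdSimplex ℝ (Fin n)) (hr : ∀ i l, 0 ≤ r i l) (j : Fin n) (l : Fin o) :
    0 ≤ resultValue π U r j l :=
  Finset.sum_nonneg fun i _ => mul_nonneg (mul_nonneg (hπ.1 i) ((hU i).1 j)) (hr i l)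

theorem resultValue_le (hπ : π ∈ stdSimplex ℝ (Fin m))
    (hU : ∀ i, U i ∈ stdSimplex ℝ (Fin n)) (hr : ∀ i l, 0 ≤ r i l) {M : ℝ}
    (hM : ∀ i l, r i l ≤ M) (j : Fin n) (l : Fin o) : resultValue π U r j l ≤ M := by
  calc resultValue π U r j l ≤ ∑ i, π i * M := by
        refine Finset.sum_le_sum fun i _ => ?_
        have h1 : U i j ≤ 1 := (hU i).2 ▸
          Finset.single_le_sum (fun k _ => (hU i).1 k) (Finset.mem_univ j)
        exact mul_le_mul (mul_le_of_le_one_right (hπ.1 i) h1) (hM i l) (hr i l) (hπ.1 i)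
    _ = M := by rw [← Finset.sum_mul, hπ.2, one_mul]

/-- The change of a weighted mean when the weight of the number `w` grows by `x`: with `S` the total
weight and `a / S` the mean, the first-order change is `x * (w - a / S) / S`, and
`c * (1 / S - 1 / (S + x))` dominates the error. -/
theorem mean_increment_ge {S x w a c : ℝ} (hS : 0 < S) (hx : 0 ≤ x)
    (hc : x * (w - a / S) ≤ c) :
    x * (w - a / S) / S ≤ ((a + x * w) / (S + x) - c / (S + x)) - (a / S - c / S) := by
  have hSx : 0 < S + x := by linarith
  have key : ((a + x * w) / (S + x) - c / (S + x)) - (a / S - c / S) - x * (w - a / S) / S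
      = x * (c - x * (w - a / S)) / (S * (S + x)) := by
    field_simp
    ring
  have : 0 ≤ x * (c - x * (w - a / S)) / (S * (S + x)) :=
    div_nonneg (mul_nonneg hx (sub_nonneg.2 hc)) (mul_pos hS hSx).le
  linarith

/-- The variance of `w` under the weights `p` is nonnegative. -/
theorem sum_mul_mul_sub_mean_nonneg {p w : Fin o → ℝ} (hp0 : ∀ l, 0 ≤ p l)
    (hp1 : ∑ l, p l = 1) : 0 ≤ ∑ l, p l * w l * (w l - ∑ k, p k * w k) := by
  set a := ∑ k, p k * w k with ha
  have : ∑ l, p l * w l * (w l - a) = ∑ l, p l * (w l - a) ^ 2 := by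
    have h0 : ∑ l, p l * (w l - a) = 0 := by
      simp only [mul_sub, Finset.sum_sub_distrib, ← Finset.sum_mul, hp1, one_mul, ← ha, sub_self]
    rw [← sub_eq_zero, ← Finset.sum_sub_distrib, ← mul_zero a, ← h0, Finset.mul_sum]
    exact Finset.sum_congr rfl fun l _ => by ring
  rw [this]
  exact Finset.sum_nonneg fun l _ => mul_nonneg (hp0 l) (sq_nonneg _)

end Deterministic

/-! ### Row sums and values along a play -/

section Paths

variable {Ω : Type*} {m n o : ℕ} {π : Fin m → ℝ}
  {U : Fin m → Fin n → ℝ} {r : Fin m → Fin o → ℝ} {R₀ : Fin n → Fin o → ℝ}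
  {intent : ℕ → Ω → Fin m} {query : ℕ → Ω → Fin n} {result : ℕ → Ω → Fin o}

theorem rewardMatrix_pos (hr : ∀ i l, 0 ≤ r i l) (hR₀ : ∀ j l, 0 < R₀ j l) (t : ℕ) (ω : Ω)
    (j : Fin n) (l : Fin o) : 0 < rewardMatrix R₀ r intent query result t ω j l := by
  induction t with
  | zero => exact hR₀ j l
  | succ t ih =>
    simp only [rewardMatrix]
    split_ifs
    · exact add_pos_of_pos_of_nonneg ih (hr _ _)
    · exact ih

/-- The total reward of the row of a query. -/
def rowSum (R₀ : Fin n → Fin o → ℝ) (r : Fin m → Fin o → ℝ)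
    (intent : ℕ → Ω → Fin m) (query : ℕ → Ω → Fin n) (result : ℕ → Ω → Fin o)
    (t : ℕ) (ω : Ω) (j : Fin n) : ℝ :=
  ∑ l, rewardMatrix R₀ r intent query result t ω j l

/-- In each round only the row of the query changes, and there only the weight of the result. -/
theorem sum_rewardMatrix_succ_mul (f : Fin o → ℝ) (t : ℕ) (ω : Ω) (j : Fin n) :
    ∑ l, rewardMatrix R₀ r intent query result (t + 1) ω j l * f l =
      ∑ l, rewardMatrix R₀ r intent query result t ω j l * f l +
        if j = query t ω then r (intent t ω) (result t ω) * f (result t ω) else 0 := by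
  by_cases hj : j = query t ω
  · rw [if_pos hj]
    have : r (intent t ω) (result t ω) * f (result t ω) =
        ∑ l, if l = result t ω then r (intent t ω) l * f l else 0 := by simp
    rw [this, ← Finset.sum_add_distrib]
    refine Finset.sum_congr rfl fun l _ => ?_
    simp only [rewardMatrix, hj, true_and]
    split_ifs <;> ring
  · simp [rewardMatrix, hj]

theorem rowSum_succ (t : ℕ) (ω : Ω) (j : Fin n) :
    rowSum R₀ r intent query result (t + 1) ω j = rowSum R₀ r intent query result t ω j +
      if j = query t ω then r (intent t ω) (result t ω) else 0 := by
  simpa [rowSum] using sum_rewardMatrix_succ_mul (R₀ := R₀) (r := r) (intent := intent)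
    (query := query) (result := result) (fun _ => 1) t ω j

theorem rowSum_pos (hr : ∀ i l, 0 ≤ r i l) (hR₀ : ∀ j l, 0 < R₀ j l) (t : ℕ) (ω : Ω)
    (j : Fin n) : 0 < rowSum R₀ r intent query result t ω j :=
  -- The result of round `t` shows that there is a result at all, so the sum is not empty.
  Finset.sum_pos (fun l _ => rewardMatrix_pos hr hR₀ t ω j l) ⟨result t ω, Finset.mem_univ _⟩

theorem rowSum_monotone (hr : ∀ i l, 0 ≤ r i l) (ω : Ω) (j : Fin n) :
    Monotone fun t => rowSum R₀ r intent query result t ω j := by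
  refine monotone_nat_of_le_succ fun t => ?_
  rw [rowSum_succ]
  split_ifs
  · exact le_add_of_nonneg_right (hr _ _)
  · simp

theorem strategy_nonneg (hr : ∀ i l, 0 ≤ r i l) (hR₀ : ∀ j l, 0 < R₀ j l) (t : ℕ) (ω : Ω)
    (j : Fin n) (l : Fin o) : 0 ≤ strategy R₀ r intent query result t ω j l :=
  div_nonneg (rewardMatrix_pos hr hR₀ t ω j l).le (rowSum_pos hr hR₀ t ω j).le

theorem sum_strategy (hr : ∀ i l, 0 ≤ r i l) (hR₀ : ∀ j l, 0 < R₀ j l) (t : ℕ) (ω : Ω)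
    (j : Fin n) : ∑ l, strategy R₀ r intent query result t ω j l = 1 := by
  simp only [strategy, ← Finset.sum_div]
  exact div_self (rowSum_pos hr hR₀ t ω j).ne'

/-- The mean value of the results that the DBMS shows for the query `j`. -/
def rowValue (π : Fin m → ℝ) (U : Fin m → Fin n → ℝ) (r : Fin m → Fin o → ℝ)
    (R₀ : Fin n → Fin o → ℝ)
    (intent : ℕ → Ω → Fin m) (query : ℕ → Ω → Fin n) (result : ℕ → Ω → Fin o)
    (t : ℕ) (ω : Ω) (j : Fin n) : ℝ :=
  ∑ l, strategy R₀ r intent query result t ω j l * resultValue π U r j l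

theorem rowValue_eq_div (t : ℕ) (ω : Ω) (j : Fin n) :
    rowValue π U r R₀ intent query result t ω j =
      (∑ l, rewardMatrix R₀ r intent query result t ω j l * resultValue π U r j l) /
        rowSum R₀ r intent query result t ω j := by
  simp only [rowValue, strategy, rowSum, Finset.sum_div]
  exact Finset.sum_congr rfl fun l _ => by ring

theorem rowValue_nonneg (hπ : π ∈ stdSimplex ℝ (Fin m)) (hU : ∀ i, U i ∈ stdSimplex ℝ (Fin n))
    (hr : ∀ i l, 0 ≤ r i l) (hR₀ : ∀ j l, 0 < R₀ j l) (t : ℕ) (ω : Ω) (j : Fin n) :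
    0 ≤ rowValue π U r R₀ intent query result t ω j :=
  Finset.sum_nonneg fun l _ =>
    mul_nonneg (strategy_nonneg hr hR₀ t ω j l) (resultValue_nonneg hπ hU hr j l)

theorem rowValue_le (hπ : π ∈ stdSimplex ℝ (Fin m)) (hU : ∀ i, U i ∈ stdSimplex ℝ (Fin n))
    (hr : ∀ i l, 0 ≤ r i l) (hR₀ : ∀ j l, 0 < R₀ j l) {M : ℝ} (hM : ∀ i l, r i l ≤ M)
    (t : ℕ) (ω : Ω) (j : Fin n) : rowValue π U r R₀ intent query result t ω j ≤ M := by
  calc rowValue π U r R₀ intent query result t ω j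
      ≤ ∑ l, strategy R₀ r intent query result t ω j l * M :=
        Finset.sum_le_sum fun l _ => mul_le_mul_of_nonneg_left (resultValue_le hπ hU hr hM j l)
          (strategy_nonneg hr hR₀ t ω j l)
    _ = M := by rw [← Finset.sum_mul, sum_strategy hr hR₀, one_mul]

/-- The correction `∑ j, c / S j` built from the row sums `S j` of the reward matrix. It decreases
along every play, and its decrement in a round dominates the second-order term in the increment of
the payoff once `c` is large. -/
def correction (c : ℝ) (R₀ : Fin n → Fin o → ℝ) (r : Fin m → Fin o → ℝ)
    (intent : ℕ → Ω → Fin m) (query : ℕ → Ω → Fin n) (result : ℕ → Ω → Fin o)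
    (t : ℕ) (ω : Ω) : ℝ :=
  ∑ j, c / rowSum R₀ r intent query result t ω j

theorem correction_nonneg {c : ℝ} (hc : 0 ≤ c) (hr : ∀ i l, 0 ≤ r i l)
    (hR₀ : ∀ j l, 0 < R₀ j l) (t : ℕ) (ω : Ω) :
    0 ≤ correction c R₀ r intent query result t ω :=
  Finset.sum_nonneg fun j _ => div_nonneg hc (rowSum_pos hr hR₀ t ω j).le

theorem correction_antitone {c : ℝ} (hc : 0 ≤ c) (hr : ∀ i l, 0 ≤ r i l)
    (hR₀ : ∀ j l, 0 < R₀ j l) (ω : Ω) :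
    Antitone fun t => correction c R₀ r intent query result t ω := fun s _ hst =>
  Finset.sum_le_sum fun j _ => div_le_div_of_nonneg_left hc (rowSum_pos hr hR₀ s ω j)
    (rowSum_monotone hr ω j hst)

theorem correction_zero (c : ℝ) (ω : Ω) :
    correction c R₀ r intent query result 0 ω = ∑ j, c / ∑ l, R₀ j l := rfl

/-- The factor by which the reward of round `t` is multiplied in the first-order increment of the
payoff when the query is `j` and the result is `l`. -/
def advantage (π : Fin m → ℝ) (U : Fin m → Fin n → ℝ) (r : Fin m → Fin o → ℝ)
    (R₀ : Fin n → Fin o → ℝ)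
    (intent : ℕ → Ω → Fin m) (query : ℕ → Ω → Fin n) (result : ℕ → Ω → Fin o)
    (t : ℕ) (ω : Ω) (j : Fin n) (l : Fin o) : ℝ :=
  (resultValue π U r j l - rowValue π U r R₀ intent query result t ω j) /
    rowSum R₀ r intent query result t ω j

theorem reward_mul_advantage_le_increment (hπ : π ∈ stdSimplex ℝ (Fin m))
    (hU : ∀ i, U i ∈ stdSimplex ℝ (Fin n)) (hr : ∀ i l, 0 ≤ r i l) (hR₀ : ∀ j l, 0 < R₀ j l)
    {M : ℝ} (hM0 : 0 ≤ M) (hM : ∀ i l, r i l ≤ M) (t : ℕ) (ω : Ω) :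
    r (intent t ω) (result t ω) *
        advantage π U r R₀ intent query result t ω (query t ω) (result t ω) ≤
      (payoff π U r (strategy R₀ r intent query result (t + 1) ω) -
          correction (M * M) R₀ r intent query result (t + 1) ω) -
        (payoff π U r (strategy R₀ r intent query result t ω) -
          correction (M * M) R₀ r intent query result t ω) := by
  simp only [payoff_eq_sum_resultValue, correction, ← Finset.sum_sub_distrib]
  change _ ≤ ∑ j, (rowValue π U r R₀ intent query result (t + 1) ω j - _ -
    (rowValue π U r R₀ intent query result t ω j - _))
  rw [Finset.sum_eq_single (query t ω)]
  · -- A reward is at most `M` and values lie in `[0, M]`, so `M * M` suits `mean_increment_ge`.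
    rw [rowValue_eq_div (t + 1), sum_rewardMatrix_succ_mul, rowSum_succ, if_pos rfl, if_pos rfl,
      advantage, rowValue_eq_div, ← mul_div_assoc]
    refine mean_increment_ge (rowSum_pos hr hR₀ t ω _) (hr _ _) ?_
    rw [← rowValue_eq_div]
    refine (mul_le_mul_of_nonneg_left ?_ (hr _ _)).trans (mul_le_mul_of_nonneg_right (hM _ _) hM0)
    exact (sub_le_self _ (rowValue_nonneg hπ hU hr hR₀ t ω _)).trans
      (resultValue_le hπ hU hr hM _ _)
  · intro j _ hj
    rw [rowValue_eq_div (t + 1), sum_rewardMatrix_succ_mul, rowSum_succ, if_neg hj, if_neg hj,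
      add_zero, add_zero, ← rowValue_eq_div, sub_self]
  · simp

/-- The conditional mean of the first-order increment of the payoff is a sum of variances. -/
theorem sum_law_mul_advantage_nonneg (hr : ∀ i l, 0 ≤ r i l) (hR₀ : ∀ j l, 0 < R₀ j l)
    (t : ℕ) (ω : Ω) :
    0 ≤ ∑ i, ∑ j, ∑ l, r i l * advantage π U r R₀ intent query result t ω j l *
      (π i * U i j * strategy R₀ r intent query result t ω j l) := by
  have : ∑ i, ∑ j, ∑ l, r i l * advantage π U r R₀ intent query result t ω j l *
      (π i * U i j * strategy R₀ r intent query result t ω j l) =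
      ∑ j, (∑ l, strategy R₀ r intent query result t ω j l * resultValue π U r j l *
        (resultValue π U r j l - rowValue π U r R₀ intent query result t ω j)) /
          rowSum R₀ r intent query result t ω j := by
    rw [Finset.sum_comm]
    refine Finset.sum_congr rfl fun j _ => ?_
    rw [Finset.sum_comm, Finset.sum_div]
    refine Finset.sum_congr rfl fun l _ => ?_
    have h1 : strategy R₀ r intent query result t ω j l * resultValue π U r j l *
        (resultValue π U r j l - rowValue π U r R₀ intent query result t ω j) /
          rowSum R₀ r intent query result t ω j =
        (∑ i, π i * U i j * r i l) * (strategy R₀ r intent query result t ω j l *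
          advantage π U r R₀ intent query result t ω j l) := by
      change _ = resultValue π U r j l * _
      rw [advantage]
      ring
    rw [h1, Finset.sum_mul]
    exact Finset.sum_congr rfl fun i _ => by ring
  rw [this]
  exact Finset.sum_nonneg fun j _ => div_nonneg
    (sum_mul_mul_sub_mean_nonneg (fun l => strategy_nonneg hr hR₀ t ω j l)
      (sum_strategy hr hR₀ t ω j)) (rowSum_pos hr hR₀ t ω j).le

end Paths

/-! ### Conditioning on the past rounds -/

section Conditioning

variable {Ω : Type*} {m n o : ℕ} {π : Fin m → ℝ}
  {U : Fin m → Fin n → ℝ} {r : Fin m → Fin o → ℝ} {R₀ : Fin n → Fin o → ℝ}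
  {intent : ℕ → Ω → Fin m} {query : ℕ → Ω → Fin n} {result : ℕ → Ω → Fin o}

theorem past_mono : Monotone (past intent query result) := fun _ _ hst =>
  iSup_mono fun _ => iSup_mono' fun hs => ⟨hs.trans_le hst, le_rfl⟩

theorem measurable_past_round {s t : ℕ} (hst : s < t) :
    Measurable[past intent query result t] fun ω => (intent s ω, query s ω, result s ω) :=
  Measurable.of_comap_le (le_iSup₂_of_le s hst le_rfl)

theorem measurable_past_rewardMatrix (t : ℕ) (j : Fin n) (l : Fin o) :
    Measurable[past intent query result t]
      fun ω => rewardMatrix R₀ r intent query result t ω j l := by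
  induction t with
  | zero => exact measurable_const
  | succ t ih =>
    have hround := measurable_past_round (intent := intent) (query := query) (result := result)
      t.lt_succ_self
    have ih' := ih.mono (past_mono t.le_succ) le_rfl
    refine Measurable.ite ?_ (ih'.add ?_) ih'
    · exact hround (MeasurableSet.of_discrete (s := {p | j = p.2.1 ∧ l = p.2.2}))
    · exact (Measurable.of_discrete (f := fun p : Fin m × Fin n × Fin o => r p.1 l)).comp hround

theorem measurable_past_rowSum (t : ℕ) (j : Fin n) :
    Measurable[past intent query result t]
      fun ω => rowSum R₀ r intent query result t ω j :=
  Finset.measurable_sum _ fun l _ => measurable_past_rewardMatrix t j l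

theorem measurable_past_strategy (t : ℕ) (j : Fin n) (l : Fin o) :
    Measurable[past intent query result t]
      fun ω => strategy R₀ r intent query result t ω j l :=
  (measurable_past_rewardMatrix t j l).div (measurable_past_rowSum t j)

theorem measurable_past_rowValue (t : ℕ) (j : Fin n) :
    Measurable[past intent query result t]
      fun ω => rowValue π U r R₀ intent query result t ω j :=
  Finset.measurable_sum _ fun l _ => (measurable_past_strategy t j l).mul_const _

theorem measurable_past_advantage (t : ℕ) (j : Fin n) (l : Fin o) :
    Measurable[past intent query result t]
      fun ω => advantage π U r R₀ intent query result t ω j l :=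
  ((measurable_past_rowValue t j).const_sub _).div (measurable_past_rowSum t j)

theorem measurable_past_correction (c : ℝ) (t : ℕ) :
    Measurable[past intent query result t] (correction c R₀ r intent query result t) :=
  Finset.measurable_sum _ fun j _ => (measurable_past_rowSum t j).const_div c

theorem measurable_payoff : Measurable (payoff π U r) := by
  unfold payoff
  fun_prop

theorem payoff_strategy_mem_Icc (hπ : π ∈ stdSimplex ℝ (Fin m))
    (hU : ∀ i, U i ∈ stdSimplex ℝ (Fin n)) (hr : ∀ i l, 0 ≤ r i l) (hR₀ : ∀ j l, 0 < R₀ j l)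
    {M : ℝ} (hM : ∀ i l, r i l ≤ M) (t : ℕ) (ω : Ω) :
    payoff π U r (strategy R₀ r intent query result t ω) ∈ Set.Icc 0 (n * M) := by
  rw [payoff_eq_sum_resultValue]
  refine ⟨Finset.sum_nonneg fun j _ => rowValue_nonneg hπ hU hr hR₀ t ω j, ?_⟩
  refine (Finset.sum_le_sum fun j _ => rowValue_le hπ hU hr hR₀ hM t ω j).trans ?_
  simp

theorem abs_reward_mul_advantage_le (hπ : π ∈ stdSimplex ℝ (Fin m))
    (hU : ∀ i, U i ∈ stdSimplex ℝ (Fin n)) (hr : ∀ i l, 0 ≤ r i l) (hR₀ : ∀ j l, 0 < R₀ j l)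
    {M : ℝ} (hM : ∀ i l, r i l ≤ M) (t : ℕ) (ω : Ω) (i : Fin m) (j : Fin n) (l : Fin o) :
    |r i l * advantage π U r R₀ intent query result t ω j l| ≤ M * (M / ∑ k, R₀ j k) := by
  rw [abs_mul, abs_of_nonneg (hr i l), advantage, abs_div,
    abs_of_pos (rowSum_pos hr hR₀ t ω j)]
  have hM0 : 0 ≤ M := (hr i l).trans (hM i l)
  have h0 : 0 < ∑ k, R₀ j k := rowSum_pos (R₀ := R₀) (intent := intent) (query := query)
    (result := result) hr hR₀ 0 ω j
  have hmono : ∑ k, R₀ j k ≤ rowSum R₀ r intent query result t ω j :=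
    rowSum_monotone (R₀ := R₀) (intent := intent) (query := query)
      (result := result) hr ω j t.zero_le
  have habs : |resultValue π U r j l - rowValue π U r R₀ intent query result t ω j| ≤ M := by
    have := resultValue_nonneg hπ hU hr j l
    have := resultValue_le hπ hU hr hM j l
    have := rowValue_nonneg hπ hU hr hR₀ t ω j (intent := intent) (query := query)
      (result := result)
    have := rowValue_le hπ hU hr hR₀ hM t ω j (intent := intent) (query := query)
      (result := result)
    rw [abs_le]
    constructor <;> linarith
  exact mul_le_mul (hM i l) (div_le_div₀ hM0 habs h0 hmono)
    (div_nonneg (abs_nonneg _) (h0.le.trans hmono)) hM0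

variable [MeasurableSpace Ω] {μ : Measure Ω}

/-- The filtration of all past rounds. It is finer than the natural filtration of the strategies,
which need not determine the row sums of the reward matrix. -/
def IsRothErevPlay.pastFiltration (h : IsRothErevPlay μ π U r R₀ intent query result) :
    Filtration ℕ (inferInstance : MeasurableSpace Ω) where
  seq := past intent query result
  mono' := past_mono
  le' _ := iSup₂_le fun s _ => Measurable.comap_le <|
    (h.measurable_intent s).prodMk ((h.measurable_query s).prodMk (h.measurable_result s))

theorem IsRothErevPlay.filtration_le_pastFiltration
    (h : IsRothErevPlay μ π U r R₀ intent query result) (t : ℕ) :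
    h.filtration t ≤ h.pastFiltration t := by
  refine iSup₂_le fun s hs => Measurable.comap_le ?_
  refine Measurable.mono ?_ (h.pastFiltration.mono hs) le_rfl
  refine @measurable_pi_lambda _ _ _ (_) _ _ fun j =>
    @measurable_pi_lambda _ _ _ (_) _ _ fun l => ?_
  exact measurable_past_strategy s j l

/-- The law of a round, integrated against a past-measurable function of the round. -/
theorem IsRothErevPlay.condExp_round [IsFiniteMeasure μ]
    (h : IsRothErevPlay μ π U r R₀ intent query result) (t : ℕ)
    {g : Ω → Fin m → Fin n → Fin o → ℝ}
    (hg : ∀ i j l, Measurable[past intent query result t] fun ω => g ω i j l)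
    {c : Fin m → Fin n → Fin o → ℝ} (hc : ∀ ω i j l, |g ω i j l| ≤ c i j l) :
    Integrable (fun ω => g ω (intent t ω) (query t ω) (result t ω)) μ ∧
    μ[fun ω => g ω (intent t ω) (query t ω) (result t ω) | past intent query result t] =ᵐ[μ]
      fun ω => ∑ i, ∑ j, ∑ l, g ω i j l *
        (π i * U i j * strategy R₀ r intent query result t ω j l) := by
  have hle : past intent query result t ≤ (inferInstance : MeasurableSpace Ω) :=
    h.pastFiltration.le t
  let I : Fin m × Fin n × Fin o → Ω → ℝ := fun p =>
    {ω | intent t ω = p.1 ∧ query t ω = p.2.1 ∧ result t ω = p.2.2}.indicator fun _ => (1 : ℝ)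
  let G : Fin m × Fin n × Fin o → Ω → ℝ := fun p ω => g ω p.1 p.2.1 p.2.2
  have hI : ∀ p, Integrable (I p) μ := fun p => (integrable_const 1).indicator <|
    ((h.measurable_intent t) (measurableSet_singleton p.1)).inter
      (((h.measurable_query t) (measurableSet_singleton p.2.1)).inter
        ((h.measurable_result t) (measurableSet_singleton p.2.2)))
  have hG : ∀ p, StronglyMeasurable[past intent query result t] (G p) := fun p =>
    (hg p.1 p.2.1 p.2.2).stronglyMeasurable
  have hGI : ∀ p, Integrable (G p * I p) μ := fun p =>
    (hI p).bdd_mul (c := c p.1 p.2.1 p.2.2) ((hG p).mono hle).aestronglyMeasurable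
      (Eventually.of_forall fun ω => hc ω _ _ _)
  have hdecomp : (fun ω => g ω (intent t ω) (query t ω) (result t ω)) = ∑ p, G p * I p := by
    funext ω
    rw [Finset.sum_apply, Finset.sum_eq_single (intent t ω, query t ω, result t ω)]
    · simp [G, I]
    · intro p _ hp
      have : ¬ (intent t ω = p.1 ∧ query t ω = p.2.1 ∧ result t ω = p.2.2) := fun hq =>
        hp (Prod.ext hq.1.symm (Prod.ext hq.2.1.symm hq.2.2.symm))
      simp [I, this]
    · simp
  rw [hdecomp]
  refine ⟨integrable_finsetSum' _ fun p _ => hGI p, ?_⟩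
  refine (condExp_finsetSum (fun p _ => hGI p) _).trans ?_
  have hterm : ∀ p, μ[G p * I p | past intent query result t] =ᵐ[μ]
      fun ω => g ω p.1 p.2.1 p.2.2 *
        (π p.1 * U p.1 p.2.1 * strategy R₀ r intent query result t ω p.2.1 p.2.2) := fun p => by
    refine (condExp_stronglyMeasurable_mul_of_bound hle (hG p) (hI p) (c p.1 p.2.1 p.2.2)
      (Eventually.of_forall fun ω => hc ω _ _ _)).trans ?_
    filter_upwards [h.law t p.1 p.2.1 p.2.2] with ω hω
    rw [Pi.mul_apply, hω]
  filter_upwards [ae_all_iff.2 hterm] with ω hω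
  rw [Finset.sum_apply, Finset.sum_congr rfl fun p _ => hω p]
  simp only [Fintype.sum_prod_type]

/-- The payoff minus the correction is a submartingale with respect to the past rounds. -/
theorem IsRothErevPlay.submartingale_payoff_sub_correction [IsFiniteMeasure μ]
    (h : IsRothErevPlay μ π U r R₀ intent query result) (hπ : π ∈ stdSimplex ℝ (Fin m))
    (hU : ∀ i, U i ∈ stdSimplex ℝ (Fin n)) (hr : ∀ i l, 0 ≤ r i l) (hR₀ : ∀ j l, 0 < R₀ j l)
    {M : ℝ} (hM0 : 0 ≤ M) (hM : ∀ i l, r i l ≤ M)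
    (hui : ∀ t, Integrable (fun ω => payoff π U r (strategy R₀ r intent query result t ω)) μ)
    (hVi : ∀ t, Integrable (correction (M * M) R₀ r intent query result t) μ) :
    Submartingale (fun t ω => payoff π U r (strategy R₀ r intent query result t ω) -
      correction (M * M) R₀ r intent query result t ω) h.pastFiltration μ := by
  refine submartingale_of_condExp_sub_nonneg_nat (fun t => ?_) (fun t => (hui t).sub (hVi t))
    fun t => ?_
  · refine Measurable.stronglyMeasurable (Measurable.sub (measurable_payoff.comp ?_)
      (measurable_past_correction _ t))
    refine @measurable_pi_lambda _ _ _ (_) _ _ fun j =>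
      @measurable_pi_lambda _ _ _ (_) _ _ fun l => ?_
    exact measurable_past_strategy t j l
  · obtain ⟨hint, hround⟩ := h.condExp_round t
      (g := fun ω i j l => r i l * advantage π U r R₀ intent query result t ω j l)
      (fun i j l => (measurable_past_advantage t j l).const_mul _)
      (fun ω i j l => abs_reward_mul_advantage_le hπ hU hr hR₀ hM t ω i j l)
    have hmono := condExp_mono (m := past intent query result t) hint
      (((hui (t + 1)).sub (hVi (t + 1))).sub ((hui t).sub (hVi t)))
      (Eventually.of_forall fun ω => reward_mul_advantage_le_increment hπ hU hr hR₀ hM0 hM t ω)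
    filter_upwards [hround, hmono] with ω h1 h2
    refine le_trans ?_ h2
    rw [h1]
    exact sum_law_mul_advantage_nonneg hr hR₀ t ω

end Conditioning

end DataGame

end

theorem theorem5p3 {Ω : Type*} [MeasurableSpace Ω] (μ : Measure Ω) [IsProbabilityMeasure μ]
    {m n o : ℕ} (π : Fin m → ℝ) (hπ : π ∈ stdSimplex ℝ (Fin m))
    (U : Fin m → Fin n → ℝ) (hU : ∀ i, U i ∈ stdSimplex ℝ (Fin n))
    (r : Fin m → Fin o → ℝ) (hr : ∀ i l, 0 ≤ r i l)
    (R₀ : Fin n → Fin o → ℝ) (hR₀ : ∀ j l, 0 < R₀ j l)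
    (intent : ℕ → Ω → Fin m) (query : ℕ → Ω → Fin n) (result : ℕ → Ω → Fin o)
    (h : DataGame.IsRothErevPlay μ π U r R₀ intent query result)
    (u : ℕ → Ω → ℝ)
    (hu : ∀ t ω, u t ω =
      DataGame.payoff π U r (DataGame.strategy R₀ r intent query result t ω)) :
    (StronglyAdapted h.filtration u ∧ (∀ t, Integrable (u t) μ) ∧
      ∃ β : ℕ → Ω → ℝ, StronglyAdapted h.filtration β ∧ (∀ t ω, 0 ≤ β t ω) ∧
        (∀ᵐ ω ∂μ, Summable fun t => β t ω) ∧
        ∀ t, ∀ᵐ ω ∂μ, u t ω - β t ω ≤ (μ[u (t + 1) | h.filtration t]) ω) ∧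
    ∀ᵐ ω ∂μ, ∃ c : ℝ, Tendsto (fun t => u t ω) atTop (𝓝 c) := by
  obtain rfl : u = fun t ω =>
      DataGame.payoff π U r (DataGame.strategy R₀ r intent query result t ω) := by
    funext t ω
    exact hu t ω
  -- A common bound `M` for the finitely many rewards.
  obtain ⟨M, hM⟩ : ∃ M, ∀ i l, r i l ≤ M := by
    obtain ⟨M, hM⟩ := (Set.finite_range fun p : Fin m × Fin o => r p.1 p.2).bddAbove
    exact ⟨M, fun i l => hM ⟨(i, l), rfl⟩⟩
  obtain ⟨ω₀⟩ : Nonempty Ω := μ.nonempty_of_neZero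
  have hM0 : 0 ≤ M := (hr (intent 0 ω₀) (result 0 ω₀)).trans (hM _ _)
  have hadapted : StronglyAdapted h.filtration fun t ω =>
      DataGame.payoff π U r (DataGame.strategy R₀ r intent query result t ω) := fun t =>
    (DataGame.measurable_payoff.comp (Filtration.stronglyAdapted_natural
      h.stronglyMeasurable_strategy t).measurable).stronglyMeasurable
  have habs : ∀ t ω,
      |DataGame.payoff π U r (DataGame.strategy R₀ r intent query result t ω)| ≤ n * M :=
    fun t ω => by
      have := DataGame.payoff_strategy_mem_Icc (intent := intent) (query := query)
        (result := result) hπ hU hr hR₀ hM t ω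
      rw [abs_of_nonneg this.1]
      exact this.2
  have hui : ∀ t, Integrable (fun ω =>
      DataGame.payoff π U r (DataGame.strategy R₀ r intent query result t ω)) μ := fun t =>
    Integrable.of_bound ((hadapted t).mono (h.filtration.le t)).aestronglyMeasurable (n * M)
      (Eventually.of_forall fun ω => habs t ω)
  have hMM : 0 ≤ M * M := mul_nonneg hM0 hM0
  have hV0 := DataGame.correction_nonneg (intent := intent) (query := query) (result := result)
    hMM hr hR₀
  have hVanti := DataGame.correction_antitone (intent := intent) (query := query)
    (result := result) hMM hr hR₀
  have hVi : ∀ t, Integrable (DataGame.correction (M * M) R₀ r intent query result t) μ :=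
    fun t => Integrable.of_bound ((DataGame.measurable_past_correction (M * M) t).mono
        (h.pastFiltration.le t) le_rfl).aestronglyMeasurable (∑ j, M * M / ∑ l, R₀ j l)
      (Eventually.of_forall fun ω => by
        rw [Real.norm_eq_abs, abs_of_nonneg (hV0 t ω)]
        exact hVanti ω t.zero_le)
  have hsub := h.submartingale_payoff_sub_correction hπ hU hr hR₀ hM0 hM hui hVi
  exact ⟨⟨hadapted, hui, DataGame.exists_summable_drift_bound h.filtration_le_pastFiltration
    hadapted hui hVi hVanti hV0 hsub⟩,
    DataGame.ae_exists_tendsto_of_submartingale_sub habs hVanti hV0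
      (fun ω => (DataGame.correction_zero (M * M) ω).le) hsub⟩
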